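/- Let $n\ge 1$ be an integer and let $p\ge 2$ be an even integer. For $1\le j\le p$ let $\mathcal S^{(j)}$ be a non-empty subset of the unit sphere $\{x\in\mathbb R^n:\|x\|_2=1\}$. Let $A_{i_1,\dots,i_p}$ ($1\le i_1,\dots,i_p\le n$), the entries of vectors $g^{(j)}\in\mathbb R^n$ ($1\le j\le p$), and the entries $A^{(j)}_{i_1,\dots,i_p}$ of arrays $A^{(j)}\in\mathbb R^{n\times\cdots\times n}$ with $p$ indices ($1\le j\le p$) be independent standard normal random variables. For $c>0$ put $$\varphi=\max_{x^{(j)}\in\mathcal S^{(j)}}\ \sum_{i_1,\dots,i_p=1}^n A_{i_1,\dots,i_p}\prod_{j=1}^p x^{(j)}_{i_j},\qquad \xi(c)=\frac1{\sqrt n}\,\frac1c\,\log \mathbb E\, e^{c\varphi},$$ $$\xi_u(c)=\frac1{\sqrt n}\left(-\frac c2(p-1)+\frac1c\log \mathbb E\exp\Big(c\max_{x^{(j)}\in\mathcal S^{(j)}}\sum_{j=1}^p (g^{(j)})^Tx^{(j)}\Big)\right),$$ $$\xi_l(c)=\frac1{\sqrt n}\,\frac1c\log \mathbb E\exp\Big(\frac{c}{\sqrt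 p}\max_{x^{(j)}\in\mathcal S^{(j)}}\sum_{j=1}^p\ \sum_{i_1,\dots,i_p=1}^n A^{(j)}_{i_1,\dots,i_p}\prod_{k=1}^p x^{(j)}_{i_k}\Big),$$ where $\max_{x^{(j)}\in\mathcal S^{(j)}}$ is taken over all arrays $(x^{(1)},\dots,x^{(p)})\in\mathcal S^{(1)}\times\cdots\times\mathcal S^{(p)}$ and means the supremum when it is not attained. Then all these expectations are finite, and for all real $c_{3,l}>0$ and $c_{3,u}>0$ $$\xi_l(c_{3,l})\le \xi(c_{3,l})\qquad\text{and}\qquad \xi(c_{3,u})\le \xi_u(c_{3,u}).$$ -/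

import Mathlib

open MeasureTheory ProbabilityTheory

namespace MultipartiteSpin

noncomputable section

/-- Arrays `(x⁽¹⁾, …, x⁽ᵖ⁾)` with `x⁽ʲ⁾ ∈ S⁽ʲ⁾`. -/
abbrev Config {n p : ℕ} (S : Fin p → Set (EuclideanSpace ℝ (Fin n))) : Type :=
  (j : Fin p) → S j

/-- The `p`-spin form `∑_{i₁,…,i_p} A_{i₁,…,i_p} ∏_k x⁽ᵏ⁾_{i_k}` of a real array `A`. -/
def spinForm {n p : ℕ} (A : (Fin p → Fin n) → ℝ) (x : Fin p → EuclideanSpace ℝ (Fin n)) : ℝ :=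
  ∑ i : Fin p → Fin n, A i * ∏ k : Fin p, x k (i k)

/-- The multipartite ground-state maximum `φ`: the supremum over all `x⁽ʲ⁾ ∈ S⁽ʲ⁾` of the
`p`-spin form (attained when the sets are compact). -/
def groundMax {n p : ℕ} (S : Fin p → Set (EuclideanSpace ℝ (Fin n)))
    (A : (Fin p → Fin n) → ℝ) : ℝ :=
  ⨆ x : Config S, spinForm A (fun j => (x j : EuclideanSpace ℝ (Fin n)))

/-- The maximum of the decoupled linear functional `∑_j (g⁽ʲ⁾)ᵀ x⁽ʲ⁾`. -/
def linearMax {n p : ℕ} (S : Fin p → Set (EuclideanSpace ℝ (Fin n)))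
    (g : Fin p → Fin n → ℝ) : ℝ :=
  ⨆ x : Config S, ∑ j : Fin p, ∑ i : Fin n, g j i * (x j : EuclideanSpace ℝ (Fin n)) i

/-- The maximum of the sum of `p` single-partite `p`-spin forms,
`∑_j ∑_{i₁,…,i_p} B⁽ʲ⁾_{i₁,…,i_p} ∏_k x⁽ʲ⁾_{i_k}`. -/
def singleMax {n p : ℕ} (S : Fin p → Set (EuclideanSpace ℝ (Fin n)))
    (B : Fin p → (Fin p → Fin n) → ℝ) : ℝ :=
  ⨆ x : Config S, ∑ j : Fin p, spinForm (B j) (fun _ => (x j : EuclideanSpace ℝ (Fin n)))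

/-- `ξ = (1/√n) (1/c) log E exp(c φ)`. -/
def xi {Ω : Type*} [MeasurableSpace Ω] {n p : ℕ} (μ : Measure Ω)
    (S : Fin p → Set (EuclideanSpace ℝ (Fin n))) (A : (Fin p → Fin n) → Ω → ℝ) (c : ℝ) : ℝ :=
  1 / √(n : ℝ) * (1 / c * Real.log (∫ ω, Real.exp (c * groundMax S (fun i => A i ω)) ∂μ))

/-- `ξ_u = (1/√n) (-(c/2)(p-1) + (1/c) log E exp(c max ∑_j (g⁽ʲ⁾)ᵀ x⁽ʲ⁾))`. -/
def xiUpper {Ω : Type*} [MeasurableSpace Ω] {n p : ℕ} (μ : Measure Ω)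
    (S : Fin p → Set (EuclideanSpace ℝ (Fin n))) (g : Fin p → Fin n → Ω → ℝ) (c : ℝ) : ℝ :=
  1 / √(n : ℝ) * (-(c / 2) * ((p : ℝ) - 1)
    + 1 / c * Real.log (∫ ω, Real.exp (c * linearMax S (fun j i => g j i ω)) ∂μ))

/-- `ξ_l = (1/√n) (1/c) log E exp((c/√p) max ∑_j ∑ B⁽ʲ⁾_{i₁,…,i_p} ∏_k x⁽ʲ⁾_{i_k})`. -/
def xiLower {Ω : Type*} [MeasurableSpace Ω] {n p : ℕ} (μ : Measure Ω)
    (S : Fin p → Set (EuclideanSpace ℝ (Fin n))) (B : Fin p → (Fin p → Fin n) → Ω → ℝ)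
    (c : ℝ) : ℝ :=
  1 / √(n : ℝ) * (1 / c *
    Real.log (∫ ω, Real.exp ((√(p : ℝ))⁻¹ * c * singleMax S (fun j i => B j i ω)) ∂μ))

/-! The three suprema are over families bounded above, so they are true suprema. -/

theorem abs_coord_le_one {n : ℕ} {x : EuclideanSpace ℝ (Fin n)}
    (hx : x ∈ Metric.sphere (0 : EuclideanSpace ℝ (Fin n)) 1) (i : Fin n) : |x i| ≤ 1 := by
  have h := PiLp.norm_apply_le x i
  rw [mem_sphere_zero_iff_norm.mp hx] at h
  simpa using h

theorem spinForm_le {n p : ℕ} (A : (Fin p → Fin n) → ℝ)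
    {x : Fin p → EuclideanSpace ℝ (Fin n)}
    (hx : ∀ j, x j ∈ Metric.sphere (0 : EuclideanSpace ℝ (Fin n)) 1) :
    spinForm A x ≤ ∑ i, |A i| := by
  refine Finset.sum_le_sum fun i _ => (le_abs_self _).trans ?_
  rw [abs_mul, Finset.abs_prod]
  exact mul_le_of_le_one_right (abs_nonneg _)
    (Finset.prod_le_one (fun _ _ => abs_nonneg _) fun k _ => abs_coord_le_one (hx k) _)

theorem isLUB_groundMax {n p : ℕ} {S : Fin p → Set (EuclideanSpace ℝ (Fin n))}
    (hS : ∀ j, S j ⊆ Metric.sphere 0 1) (hne : ∀ j, (S j).Nonempty)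
    (A : (Fin p → Fin n) → ℝ) :
    IsLUB (Set.range fun x : Config S => spinForm A fun j => (x j : EuclideanSpace ℝ (Fin n)))
      (groundMax S A) := by
  haveI : ∀ j, Nonempty (S j) := fun j => (hne j).to_subtype
  refine isLUB_ciSup ⟨∑ i, |A i|, ?_⟩
  rintro _ ⟨x, rfl⟩
  exact spinForm_le A fun j => hS j (x j).2

theorem isLUB_linearMax {n p : ℕ} {S : Fin p → Set (EuclideanSpace ℝ (Fin n))}
    (hS : ∀ j, S j ⊆ Metric.sphere 0 1) (hne : ∀ j, (S j).Nonempty)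
    (g : Fin p → Fin n → ℝ) :
    IsLUB (Set.range fun x : Config S =>
      ∑ j, ∑ i, g j i * (x j : EuclideanSpace ℝ (Fin n)) i) (linearMax S g) := by
  haveI : ∀ j, Nonempty (S j) := fun j => (hne j).to_subtype
  refine isLUB_ciSup ⟨∑ j, ∑ i, |g j i|, ?_⟩
  rintro _ ⟨x, rfl⟩
  refine Finset.sum_le_sum fun j _ => Finset.sum_le_sum fun i _ => (le_abs_self _).trans ?_
  rw [abs_mul]
  exact mul_le_of_le_one_right (abs_nonneg _) (abs_coord_le_one (hS j (x j).2) i)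

theorem isLUB_singleMax {n p : ℕ} {S : Fin p → Set (EuclideanSpace ℝ (Fin n))}
    (hS : ∀ j, S j ⊆ Metric.sphere 0 1) (hne : ∀ j, (S j).Nonempty)
    (B : Fin p → (Fin p → Fin n) → ℝ) :
    IsLUB (Set.range fun x : Config S =>
      ∑ j, spinForm (B j) fun _ => (x j : EuclideanSpace ℝ (Fin n))) (singleMax S B) := by
  haveI : ∀ j, Nonempty (S j) := fun j => (hne j).to_subtype
  refine isLUB_ciSup ⟨∑ j, ∑ i, |B j i|, ?_⟩
  rintro _ ⟨x, rfl⟩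
  exact Finset.sum_le_sum fun j _ => spinForm_le (B j) fun _ => hS j (x j).2

end

end MultipartiteSpin

/-!
The three maxima are suprema over `x ∈ S⁽¹⁾ × ⋯ × S⁽ᵖ⁾` of centred Gaussian fields. Write
`aⱼ = ⟨x⁽ʲ⁾, y⁽ʲ⁾⟩ ∈ [-1, 1]`. The `p`-spin field has covariance `∏ⱼ aⱼ`; the field
`p^{-1/2} ∑ⱼ B⁽ʲ⁾(x⁽ʲ⁾, …, x⁽ʲ⁾)` has covariance `p⁻¹ ∑ⱼ aⱼᵖ`; the linear field has covariance
`∑ⱼ aⱼ`. The first two have variance `1`. Adding `√(p - 1)` times an independent standard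
Gaussian to the `p`-spin field raises its variance to `p`, that of the linear field, and multiplies
`𝔼 exp (c φ)` by `exp (c² (p - 1) / 2)`. Both bounds then follow from Slepian's comparison
`integral_exp_mul_iSup_linField_le`: for equal variances, the field with the larger covariances has
the smaller `𝔼 exp (c sup)`. The covariance inequalities needed are `∏ aⱼ ≤ p⁻¹ ∑ aⱼᵖ` (arithmetic
and geometric means, `p` even; `prod_le_inv_mul_sum_pow`) and `1 - ∏ aⱼ ≤ ∑ (1 - aⱼ)`
(`one_sub_prod_le_sum`).

Slepian's comparison is proved by Gaussian interpolation. For finitely many indices and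
`0 ≤ γ ≤ 1`, let `F(x) = (∑ᵢ exp xᵢ) ^ γ`, whose mixed second derivatives are nonpositive. Along
`cos t • X + sin t • Y` with `X` and `Y` independent, integration by parts
(`integral_coord_mul`) expresses the derivative of `𝔼 F` through the covariance difference times
these second derivatives, so `𝔼 F(X) ≤ 𝔼 F(Y)` (`integral_expSum_rpow_le`). Since
`exp (c max xᵢ) ≤ F (c x / γ) ≤ N ^ γ exp (c max xᵢ)`, letting `γ → 0` gives the comparison for
finite maxima, and dominated convergence along a dense sequence gives it for suprema over a
separable space.
-/

/-! ### Gaussian integration by parts -/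

namespace GaussianComparison

/-- The standard Gaussian measure on `κ → ℝ`: the coordinates are independent standard normal
variables. -/
noncomputable abbrev stdGaussianPi (κ : Type*) [Fintype κ] : Measure (κ → ℝ) :=
  Measure.pi fun _ => gaussianReal 0 1

theorem integrable_gaussianReal_iff {f : ℝ → ℝ} :
    Integrable f (gaussianReal 0 1) ↔ Integrable (fun x => gaussianPDFReal 0 1 x * f x) := by
  rw [gaussianReal_of_var_ne_zero _ one_ne_zero,
    integrable_withDensity_iff_integrable_smul' (measurable_gaussianPDF 0 1)
      (ae_of_all _ fun _ => gaussianPDF_lt_top)]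
  simp [toReal_gaussianPDF]

theorem hasDerivAt_gaussianPDFReal (x : ℝ) :
    HasDerivAt (gaussianPDFReal 0 1) (-(x * gaussianPDFReal 0 1 x)) x := by
  have h1 : HasDerivAt (fun y : ℝ => -(y - 0) ^ 2 / (2 * ((1 : NNReal) : ℝ))) (-x) x := by
    have h := ((((hasDerivAt_id x).sub_const 0).pow 2).neg).div_const (2 * ((1 : NNReal) : ℝ))
    refine h.congr_deriv ?_
    simp only [NNReal.coe_one, id, Nat.cast_ofNat]
    ring
  have h2 := h1.exp.const_mul (√(2 * Real.pi * ((1 : NNReal) : ℝ)))⁻¹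
  refine h2.congr_deriv ?_
  simp only [gaussianPDFReal]
  ring

/-- Stein's identity for the standard normal law. -/
theorem integral_id_mul_gaussianReal {h h' : ℝ → ℝ} (hd : ∀ x, HasDerivAt h (h' x) x)
    (hi : Integrable h (gaussianReal 0 1)) (hi' : Integrable h' (gaussianReal 0 1))
    (hxi : Integrable (fun x => x * h x) (gaussianReal 0 1)) :
    ∫ x, x * h x ∂gaussianReal 0 1 = ∫ x, h' x ∂gaussianReal 0 1 := by
  rw [integrable_gaussianReal_iff] at hi hi' hxi
  have key := integral_mul_deriv_eq_deriv_mul_of_integrable (u := h) (u' := h')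
    (v := gaussianPDFReal 0 1) (v' := fun x => -(x * gaussianPDFReal 0 1 x))
    (fun x _ => hd x) (fun x _ => hasDerivAt_gaussianPDFReal x)
    (by
      refine hxi.neg.congr (ae_of_all _ fun x => ?_)
      simp only [Pi.neg_apply, Pi.mul_apply]
      ring)
    (by
      refine hi'.congr (ae_of_all _ fun x => ?_)
      simp only [Pi.mul_apply]
      ring)
    (by
      refine hi.congr (ae_of_all _ fun x => ?_)
      simp only [Pi.mul_apply]
      ring)
  rw [integral_gaussianReal_eq_integral_smul one_ne_zero,
    integral_gaussianReal_eq_integral_smul one_ne_zero]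
  calc ∫ x, gaussianPDFReal 0 1 x • (x * h x)
      = -∫ x, h x * -(x * gaussianPDFReal 0 1 x) := by
        rw [← integral_neg]
        refine integral_congr_ae (ae_of_all _ fun x => ?_)
        simp only [smul_eq_mul]
        ring
    _ = ∫ x, h' x * gaussianPDFReal 0 1 x := by rw [key, neg_neg]
    _ = _ := by
        refine integral_congr_ae (ae_of_all _ fun x => ?_)
        simp only [smul_eq_mul]
        ring

variable {κ : Type*} [Fintype κ]

/-- Resampling one coordinate independently does not change the standard Gaussian measure. -/
theorem measurePreserving_update [DecidableEq κ] (k : κ) :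
    MeasurePreserving (fun z : ℝ × (κ → ℝ) => Function.update z.2 k z.1)
      ((gaussianReal 0 1).prod (stdGaussianPi κ)) (stdGaussianPi κ) := by
  have hm : Measurable fun z : ℝ × (κ → ℝ) => Function.update z.2 k z.1 := by
    refine measurable_pi_lambda _ fun j => ?_
    by_cases hj : j = k
    · subst hj
      simpa using measurable_fst
    · simpa [Function.update_of_ne hj] using! (measurable_pi_apply j).comp measurable_snd
  refine ⟨hm, (Measure.pi_eq fun s hs => ?_).symm⟩
  rw [Measure.map_apply hm (MeasurableSet.univ_pi hs)]
  have hpre : (fun z : ℝ × (κ → ℝ) => Function.update z.2 k z.1) ⁻¹' Set.univ.pi s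
      = s k ×ˢ Set.univ.pi (Function.update s k Set.univ) := by
    ext ⟨x, y⟩
    simp only [Set.mem_preimage, Set.mem_univ_pi, Set.mem_prod]
    constructor
    · intro h
      refine ⟨by simpa using h k, fun j => ?_⟩
      by_cases hj : j = k
      · subst hj; simp
      · simpa [Function.update_of_ne hj] using h j
    · rintro ⟨h1, h2⟩ j
      by_cases hj : j = k
      · subst hj; simpa using h1
      · simpa [Function.update_of_ne hj] using h2 j
  rw [hpre, Measure.prod_prod, Measure.pi_pi,
    ← Finset.mul_prod_erase Finset.univ (fun i => gaussianReal 0 1 (s i)) (Finset.mem_univ k),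
    ← Finset.mul_prod_erase Finset.univ
      (fun i => gaussianReal 0 1 (Function.update s k Set.univ i)) (Finset.mem_univ k)]
  simp only [Function.update_self, measure_univ, one_mul]
  congr 1
  refine Finset.prod_congr rfl fun j hj => ?_
  rw [Function.update_of_ne (Finset.ne_of_mem_erase hj)]

theorem integrable_comp_update [DecidableEq κ] (k : κ) {f : (κ → ℝ) → ℝ}
    (hf : Integrable f (stdGaussianPi κ)) :
    Integrable (fun z : ℝ × (κ → ℝ) => f (Function.update z.2 k z.1))
      ((gaussianReal 0 1).prod (stdGaussianPi κ)) :=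
  (measurePreserving_update k).integrable_comp_of_integrable hf

theorem integral_eq_integral_update [DecidableEq κ] (k : κ) {f : (κ → ℝ) → ℝ}
    (hf : Integrable f (stdGaussianPi κ)) :
    ∫ G, f G ∂stdGaussianPi κ
      = ∫ G, ∫ x, f (Function.update G k x) ∂gaussianReal 0 1 ∂stdGaussianPi κ := by
  have hmp := measurePreserving_update (κ := κ) k
  rw [← integral_prod_symm _ (integrable_comp_update k hf),
    ← integral_map hmp.measurable.aemeasurable (by rw [hmp.map_eq]; exact hf.1), hmp.map_eq]

/-- Gaussian integration by parts in the coordinate `k`. -/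
theorem integral_coord_mul [DecidableEq κ] (k : κ) {h h' : (κ → ℝ) → ℝ}
    (hd : ∀ G, HasDerivAt (fun x => h (Function.update G k x)) (h' G) (G k))
    (hi : Integrable h (stdGaussianPi κ)) (hi' : Integrable h' (stdGaussianPi κ))
    (hxi : Integrable (fun G => G k * h G) (stdGaussianPi κ)) :
    ∫ G, G k * h G ∂stdGaussianPi κ = ∫ G, h' G ∂stdGaussianPi κ := by
  rw [integral_eq_integral_update k hxi, integral_eq_integral_update k hi']
  refine integral_congr_ae ?_
  filter_upwards [(integrable_comp_update k hi).prod_left_ae,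
    (integrable_comp_update k hi').prod_left_ae,
    (integrable_comp_update k hxi).prod_left_ae] with G h1 h2 h3
  simp only [Function.update_self] at h3 ⊢
  refine integral_id_mul_gaussianReal (fun x => ?_) h1 h2 h3
  simpa using hd (Function.update G k x)

/-- A subfamily of the coordinates of a standard Gaussian vector is a standard Gaussian vector. -/
theorem measurePreserving_comp_injective {κ' : Type*} [Fintype κ'] {e : κ' → κ}
    (he : Function.Injective e) :
    MeasurePreserving (fun G : κ → ℝ => fun k => G (e k)) (stdGaussianPi κ)
      (stdGaussianPi κ') := by
  have hind : iIndepFun (fun (k : κ) (G : κ → ℝ) => G k) (stdGaussianPi κ) :=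
    iIndepFun_pi (X := fun _ => id) fun _ => aemeasurable_id
  refine ⟨by fun_prop, ?_⟩
  rw [(iIndepFun_iff_map_fun_eq_pi_map
    (fun k => (measurable_pi_apply (e k)).aemeasurable)).1 (hind.precomp he)]
  congr 1
  funext k
  exact (measurePreserving_eval (fun _ : κ => gaussianReal 0 1) (e k)).map_eq

/-- The exponential envelope that dominates every function integrated below. -/
theorem integrable_exp_mul_sum_abs (K : ℝ) :
    Integrable (fun G : κ → ℝ => Real.exp (K * ∑ k, |G k|)) (stdGaussianPi κ) := by
  have h1 : Integrable (fun x : ℝ => Real.exp (K * |x|)) (gaussianReal 0 1) :=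
    integrable_exp_mul_abs (integrable_exp_mul_gaussianReal K)
      (integrable_exp_mul_gaussianReal (-K))
  have h2 := Integrable.fintype_prod (ι := κ) (f := fun _ x => Real.exp (K * |x|))
    (μ := fun _ => gaussianReal 0 1) fun _ => h1
  simpa only [← Real.exp_sum, ← Finset.mul_sum] using h2

end GaussianComparison

/-! ### Powers of partition functions of Gaussian fields -/

namespace GaussianComparison

variable {ι κ : Type*} [Fintype κ]

/-- The linear field `i ↦ ∑ₖ Lᵢₖ Gₖ` driven by the vector `G`. -/
def linField (L : ι → κ → ℝ) (G : κ → ℝ) (i : ι) : ℝ := ∑ k, L i k * G k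

theorem abs_linField_le {L : ι → κ → ℝ} {K : ℝ} (hL : ∀ i k, |L i k| ≤ K) (G : κ → ℝ) (i : ι) :
    |linField L G i| ≤ K * ∑ k, |G k| := by
  rw [linField, Finset.mul_sum]
  refine (Finset.abs_sum_le_sum_abs _ _).trans (Finset.sum_le_sum fun k _ => ?_)
  rw [abs_mul]
  exact mul_le_mul_of_nonneg_right (hL i k) (abs_nonneg _)

@[fun_prop]
theorem measurable_linField (L : ι → κ → ℝ) (i : ι) : Measurable fun G => linField L G i := by
  unfold linField
  fun_prop

theorem hasDerivAt_linField_update [DecidableEq κ] (L : ι → κ → ℝ) (G : κ → ℝ) (k : κ) (i : ι) :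
    HasDerivAt (fun s => linField L (Function.update G k s) i) (L i k) (G k) := by
  have h : (fun s => linField L (Function.update G k s) i)
      = fun s => L i k * s + ∑ l ∈ Finset.univ.erase k, L i l * G l := by
    funext s
    rw [linField, ← Finset.add_sum_erase _ _ (Finset.mem_univ k), Function.update_self]
    congr 1
    exact Finset.sum_congr rfl fun l hl => by
      rw [Function.update_of_ne (Finset.ne_of_mem_erase hl)]
  rw [h]
  simpa using ((hasDerivAt_id (G k)).const_mul (L i k)).add_const
    (∑ l ∈ Finset.univ.erase k, L i l * G l)

variable [Fintype ι]

/-- The partition function `∑ᵢ exp xᵢ`. Its powers with small exponent `γ`, evaluated at `x / γ`,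
approximate `exp (maxᵢ xᵢ)`. -/
noncomputable def expSum (x : ι → ℝ) : ℝ := ∑ i, Real.exp (x i)

theorem expSum_pos [Nonempty ι] (x : ι → ℝ) : 0 < expSum x :=
  Finset.sum_pos (fun _ _ => Real.exp_pos _) Finset.univ_nonempty

theorem exp_le_expSum (x : ι → ℝ) (i : ι) : Real.exp (x i) ≤ expSum x :=
  Finset.single_le_sum (f := fun i => Real.exp (x i)) (fun _ _ => (Real.exp_pos _).le)
    (Finset.mem_univ i)

theorem rpow_le_one_add {s γ : ℝ} (hs : 0 < s) (h0 : 0 ≤ γ) (h1 : γ ≤ 1) : s ^ γ ≤ 1 + s := by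
  rcases le_total s 1 with h | h
  · linarith [Real.rpow_le_one hs.le h h0]
  · have := Real.rpow_le_rpow_of_exponent_le h h1
    rw [Real.rpow_one] at this
    linarith

theorem exp_mul_expSum_rpow_le [Nonempty ι] (x : ι → ℝ) (i : ι) (γ : ℝ) :
    Real.exp (x i) * expSum x ^ (γ - 1) ≤ expSum x ^ γ := by
  have hs := expSum_pos x
  calc Real.exp (x i) * expSum x ^ (γ - 1) ≤ expSum x * expSum x ^ (γ - 1) :=
        mul_le_mul_of_nonneg_right (exp_le_expSum x i) (Real.rpow_nonneg hs.le _)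
    _ = expSum x ^ γ := by
        rw [Real.rpow_sub_one hs.ne']
        field_simp

theorem exp_mul_exp_mul_expSum_rpow_le [Nonempty ι] (x : ι → ℝ) (i j : ι) (γ : ℝ) :
    Real.exp (x i) * Real.exp (x j) * expSum x ^ (γ - 2) ≤ expSum x ^ γ := by
  refine le_trans ?_ (exp_mul_expSum_rpow_le x i γ)
  rw [mul_assoc]
  refine mul_le_mul_of_nonneg_left ?_ (Real.exp_pos _).le
  have := exp_mul_expSum_rpow_le x j (γ - 1)
  rwa [show γ - 1 - 1 = γ - 2 by ring] at this

theorem expSum_linField_rpow_le [Nonempty ι] {L : ι → κ → ℝ} {K : ℝ} (hK : 0 ≤ K)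
    (hL : ∀ i k, |L i k| ≤ K) {γ : ℝ} (h0 : 0 ≤ γ) (h1 : γ ≤ 1) (G : κ → ℝ) :
    expSum (linField L G) ^ γ ≤ (1 + Fintype.card ι) * Real.exp (K * ∑ k, |G k|) := by
  refine (rpow_le_one_add (expSum_pos _) h0 h1).trans ?_
  have h2 : expSum (linField L G) ≤ Fintype.card ι * Real.exp (K * ∑ k, |G k|) := by
    refine (Finset.sum_le_sum (g := fun _ => Real.exp (K * ∑ k, |G k|)) fun i _ =>
      Real.exp_le_exp.2 ((le_abs_self _).trans (abs_linField_le hL G i))).trans ?_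
    simp
  have h3 : 1 ≤ Real.exp (K * ∑ k, |G k|) :=
    Real.one_le_exp (mul_nonneg hK (Finset.sum_nonneg fun _ _ => abs_nonneg _))
  linarith

@[fun_prop]
theorem measurable_expSum_linField (L : ι → κ → ℝ) :
    Measurable fun G => expSum (linField L G) := by
  unfold expSum
  fun_prop

/-- Functions of at most exponential growth are integrable. -/
theorem integrable_of_abs_le_exp {f : (κ → ℝ) → ℝ} (hf : Measurable f) {C K : ℝ}
    (hb : ∀ G, |f G| ≤ C * Real.exp (K * ∑ k, |G k|)) : Integrable f (stdGaussianPi κ) :=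
  ((integrable_exp_mul_sum_abs K).const_mul C).mono' hf.aestronglyMeasurable (ae_of_all _ hb)

theorem integrable_expSum_rpow [Nonempty ι] (L : ι → κ → ℝ) {K : ℝ} (hK : 0 ≤ K)
    (hL : ∀ i k, |L i k| ≤ K) {γ : ℝ} (h0 : 0 ≤ γ) (h1 : γ ≤ 1) :
    Integrable (fun G => expSum (linField L G) ^ γ) (stdGaussianPi κ) := by
  refine integrable_of_abs_le_exp (C := 1 + Fintype.card ι) (K := K) (by fun_prop) fun G => ?_
  rw [abs_of_nonneg (Real.rpow_nonneg (expSum_pos _).le _)]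
  exact expSum_linField_rpow_le hK hL h0 h1 G

theorem integrable_exp_mul_expSum_rpow [Nonempty ι] (L : ι → κ → ℝ) {K : ℝ} (hK : 0 ≤ K)
    (hL : ∀ i k, |L i k| ≤ K) {γ : ℝ} (h0 : 0 ≤ γ) (h1 : γ ≤ 1) (i : ι) :
    Integrable (fun G => Real.exp (linField L G i) * expSum (linField L G) ^ (γ - 1))
      (stdGaussianPi κ) := by
  refine (integrable_expSum_rpow L hK hL h0 h1).mono' (by fun_prop) (ae_of_all _ fun G => ?_)
  rw [Real.norm_eq_abs, abs_of_nonneg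
    (mul_nonneg (Real.exp_pos _).le (Real.rpow_nonneg (expSum_pos _).le _))]
  exact exp_mul_expSum_rpow_le _ i γ

theorem integrable_exp_mul_exp_mul_expSum_rpow [Nonempty ι] (L : ι → κ → ℝ) {K : ℝ} (hK : 0 ≤ K)
    (hL : ∀ i k, |L i k| ≤ K) {γ : ℝ} (h0 : 0 ≤ γ) (h1 : γ ≤ 1) (i j : ι) :
    Integrable (fun G => Real.exp (linField L G i) * Real.exp (linField L G j)
      * expSum (linField L G) ^ (γ - 2)) (stdGaussianPi κ) := by
  refine (integrable_expSum_rpow L hK hL h0 h1).mono' (by fun_prop) (ae_of_all _ fun G => ?_)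
  rw [Real.norm_eq_abs, abs_of_nonneg (mul_nonneg (mul_nonneg (Real.exp_pos _).le
    (Real.exp_pos _).le) (Real.rpow_nonneg (expSum_pos _).le _))]
  exact exp_mul_exp_mul_expSum_rpow_le _ i j γ

theorem abs_coord_le_exp (G : κ → ℝ) (k : κ) : |G k| ≤ Real.exp (∑ k, |G k|) := by
  have h1 : |G k| ≤ ∑ k, |G k| :=
    Finset.single_le_sum (f := fun k => |G k|) (fun _ _ => abs_nonneg _) (Finset.mem_univ k)
  linarith [Real.add_one_le_exp (∑ k, |G k|)]

theorem abs_coord_mul_exp_mul_expSum_rpow_le [Nonempty ι] {L : ι → κ → ℝ} {K : ℝ} (hK : 0 ≤ K)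
    (hL : ∀ i k, |L i k| ≤ K) {γ : ℝ} (h0 : 0 ≤ γ) (h1 : γ ≤ 1) (i : ι) (k : κ) (G : κ → ℝ) :
    |G k * (Real.exp (linField L G i) * expSum (linField L G) ^ (γ - 1))|
      ≤ (1 + Fintype.card ι) * Real.exp ((K + 1) * ∑ k, |G k|) := by
  rw [abs_mul, abs_of_nonneg (mul_nonneg (Real.exp_pos (linField L G i)).le
    (Real.rpow_nonneg (expSum_pos (linField L G)).le (γ - 1)))]
  calc _ ≤ Real.exp (∑ k, |G k|) * ((1 + Fintype.card ι) * Real.exp (K * ∑ k, |G k|)) :=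
        mul_le_mul (abs_coord_le_exp G k)
          ((exp_mul_expSum_rpow_le _ i γ).trans (expSum_linField_rpow_le hK hL h0 h1 G))
          (mul_nonneg (Real.exp_pos _).le (Real.rpow_nonneg (expSum_pos _).le _))
          (Real.exp_pos _).le
    _ = _ := by
        rw [add_mul K, one_mul, Real.exp_add]
        ring

theorem integrable_coord_mul [Nonempty ι] (L : ι → κ → ℝ) {K : ℝ} (hK : 0 ≤ K)
    (hL : ∀ i k, |L i k| ≤ K) {γ : ℝ} (h0 : 0 ≤ γ) (h1 : γ ≤ 1) (i : ι) (k : κ) :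
    Integrable (fun G => G k * (Real.exp (linField L G i) * expSum (linField L G) ^ (γ - 1)))
      (stdGaussianPi κ) :=
  integrable_of_abs_le_exp (by fun_prop)
    (abs_coord_mul_exp_mul_expSum_rpow_le hK hL h0 h1 i k)

theorem hasDerivAt_expSum {x : ℝ → ι → ℝ} {x' : ι → ℝ} {t : ℝ}
    (hx : ∀ i, HasDerivAt (fun s => x s i) (x' i) t) :
    HasDerivAt (fun s => expSum (x s)) (∑ i, x' i * Real.exp (x t i)) t := by
  refine (HasDerivAt.fun_sum fun i (_ : i ∈ Finset.univ) => (hx i).exp).congr_deriv ?_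
  exact Finset.sum_congr rfl fun i _ => mul_comm _ _

/-- Gaussian integration by parts for the gradient of `expSum ^ γ` along a Gaussian field. -/
theorem integral_coord_mul_exp_mul_expSum_rpow [Nonempty ι] (L : ι → κ → ℝ) {K : ℝ}
    (hK : 0 ≤ K) (hL : ∀ i k, |L i k| ≤ K) {γ : ℝ} (h0 : 0 ≤ γ) (h1 : γ ≤ 1) (i : ι) (k : κ) :
    ∫ G, G k * (Real.exp (linField L G i) * expSum (linField L G) ^ (γ - 1)) ∂stdGaussianPi κ
      = L i k * (∫ G, Real.exp (linField L G i) * expSum (linField L G) ^ (γ - 1)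
          ∂stdGaussianPi κ)
        + (γ - 1) * ∑ j, L j k * ∫ G, Real.exp (linField L G i) * Real.exp (linField L G j)
            * expSum (linField L G) ^ (γ - 2) ∂stdGaussianPi κ := by
  classical
  have hI1 := integrable_exp_mul_expSum_rpow L hK hL h0 h1 i
  have hI2 := fun j => integrable_exp_mul_exp_mul_expSum_rpow L hK hL h0 h1 i j
  have hs : Integrable (fun G => ∑ j, L j k * (Real.exp (linField L G i)
      * Real.exp (linField L G j) * expSum (linField L G) ^ (γ - 2))) (stdGaussianPi κ) :=
    integrable_finsetSum _ fun j _ => (hI2 j).const_mul _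
  rw [integral_coord_mul k (h' := fun G =>
      L i k * (Real.exp (linField L G i) * expSum (linField L G) ^ (γ - 1))
        + (γ - 1) * ∑ j, L j k * (Real.exp (linField L G i) * Real.exp (linField L G j)
            * expSum (linField L G) ^ (γ - 2))) ?_ hI1
      ((hI1.const_mul _).add (hs.const_mul _)) (integrable_coord_mul L hK hL h0 h1 i k)]
  · rw [integral_add (hI1.const_mul _) (hs.const_mul _), integral_const_mul, integral_const_mul,
      integral_finsetSum _ fun j _ => (hI2 j).const_mul _]
    simp only [integral_const_mul]
  · intro G
    have hx := hasDerivAt_linField_update L G k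
    have hd := ((hx i).exp).mul ((hasDerivAt_expSum
      (x := fun s => linField L (Function.update G k s)) hx).rpow_const (p := γ - 1)
        (Or.inl (expSum_pos _).ne'))
    refine hd.congr_deriv ?_
    simp only [Function.update_eq_self]
    rw [show γ - 1 - 1 = γ - 2 by ring, Finset.sum_mul, Finset.sum_mul, Finset.mul_sum,
      Finset.mul_sum]
    congr 1
    · ring
    · exact Finset.sum_congr rfl fun j _ => by ring

/-- The derivative of `𝔼 (expSum X) ^ γ` along a path of Gaussian fields is nonnegative, as soon as
the variances are constant and the covariances decrease: the mixed second derivatives of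
`expSum ^ γ` are nonpositive because `γ ≤ 1`. Here `M` is the derivative of the coefficient
matrix `L`. -/
theorem integral_sum_linField_mul_nonneg [Nonempty ι] (L M : ι → κ → ℝ) {K : ℝ}
    (hK : 0 ≤ K) (hL : ∀ i k, |L i k| ≤ K) {γ : ℝ} (h0 : 0 ≤ γ) (h1 : γ ≤ 1)
    (hvar : ∀ i, ∑ k, M i k * L i k = 0) (hcov : ∀ i j, ∑ k, M i k * L j k ≤ 0) :
    0 ≤ ∫ G, ∑ i, linField M G i * (Real.exp (linField L G i)
      * expSum (linField L G) ^ (γ - 1)) ∂stdGaussianPi κ := by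
  have hI := integrable_coord_mul L hK hL h0 h1
  have hexp : ∀ G : κ → ℝ, ∑ i, linField M G i * (Real.exp (linField L G i)
      * expSum (linField L G) ^ (γ - 1)) = ∑ i, ∑ k, M i k * (G k * (Real.exp (linField L G i)
      * expSum (linField L G) ^ (γ - 1))) := fun G => by
    refine Finset.sum_congr rfl fun i _ => ?_
    rw [linField, Finset.sum_mul]
    exact Finset.sum_congr rfl fun k _ => by ring
  simp only [hexp]
  rw [integral_finsetSum _ fun i _ => integrable_finsetSum _ fun k _ => (hI i k).const_mul _]
  refine Finset.sum_nonneg fun i _ => ?_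
  rw [integral_finsetSum _ fun k _ => (hI i k).const_mul _]
  simp only [integral_const_mul, integral_coord_mul_exp_mul_expSum_rpow L hK hL h0 h1 i]
  have hsplit : ∀ (a : ℝ) (b : ι → ℝ), ∑ k, M i k * (L i k * a + (γ - 1) * ∑ j, L j k * b j)
      = (∑ k, M i k * L i k) * a + (1 - γ) * ∑ j, -(∑ k, M i k * L j k) * b j := by
    intro a b
    have h2 : ∑ j, -(∑ k, M i k * L j k) * b j = -∑ k, M i k * ∑ j, L j k * b j := by
      simp only [neg_mul, Finset.sum_neg_distrib, Finset.sum_mul, Finset.mul_sum]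
      rw [Finset.sum_comm]
      simp only [mul_assoc]
    rw [h2, Finset.sum_mul, mul_neg, ← neg_mul, Finset.mul_sum, ← Finset.sum_add_distrib]
    exact Finset.sum_congr rfl fun k _ => by ring
  rw [hsplit, hvar, zero_mul, zero_add]
  refine mul_nonneg (by linarith) (Finset.sum_nonneg fun j _ => mul_nonneg
    (neg_nonneg.2 (hcov i j)) (integral_nonneg fun G => ?_))
  exact mul_nonneg (mul_nonneg (Real.exp_pos _).le (Real.exp_pos _).le)
    (Real.rpow_nonneg (expSum_pos _).le _)

/-- Differentiation under the integral sign along a path `L` of coefficient matrices. -/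
theorem hasDerivAt_integral_expSum_rpow [Nonempty ι] {L L' : ℝ → ι → κ → ℝ} {K : ℝ} (hK : 0 ≤ K)
    (hL : ∀ t i k, |L t i k| ≤ K) (hL' : ∀ t i k, |L' t i k| ≤ K)
    (hd : ∀ t i k, HasDerivAt (fun s => L s i k) (L' t i k) t)
    {γ : ℝ} (h0 : 0 ≤ γ) (h1 : γ ≤ 1) (t : ℝ) :
    HasDerivAt (fun s => ∫ G, expSum (linField (L s) G) ^ γ ∂stdGaussianPi κ)
      (∫ G, γ * ∑ i, linField (L' t) G i * (Real.exp (linField (L t) G i)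
        * expSum (linField (L t) G) ^ (γ - 1)) ∂stdGaussianPi κ) t := by
  have hbound : Integrable (fun G : κ → ℝ => ∑ _i : ι, ∑ _k : κ,
      K * ((1 + Fintype.card ι) * Real.exp ((K + 1) * ∑ k, |G k|))) (stdGaussianPi κ) :=
    integrable_finsetSum _ fun _ _ => integrable_finsetSum _ fun _ _ =>
      ((integrable_exp_mul_sum_abs _).const_mul _).const_mul _
  refine (hasDerivAt_integral_of_dominated_loc_of_deriv_le
    (F := fun s G => expSum (linField (L s) G) ^ γ)
    (F' := fun s G => γ * ∑ i, linField (L' s) G i * (Real.exp (linField (L s) G i)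
        * expSum (linField (L s) G) ^ (γ - 1))) Filter.univ_mem
    (Filter.Eventually.of_forall fun s => ?_) (integrable_expSum_rpow (L t) hK (hL t) h0 h1)
    ?_ (ae_of_all _ fun G s _ => ?_) hbound (ae_of_all _ fun G s _ => ?_)).2
  · exact Measurable.aestronglyMeasurable (by fun_prop)
  · exact Measurable.aestronglyMeasurable (by fun_prop)
  · rw [norm_mul, Real.norm_of_nonneg h0]
    refine (mul_le_of_le_one_left (norm_nonneg _) h1).trans ?_
    refine (norm_sum_le _ _).trans (Finset.sum_le_sum fun i _ => ?_)
    rw [linField, Finset.sum_mul]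
    refine (norm_sum_le _ _).trans (Finset.sum_le_sum fun k _ => ?_)
    rw [mul_assoc, norm_mul]
    exact mul_le_mul (hL' s i k)
      (abs_coord_mul_exp_mul_expSum_rpow_le hK (hL s) h0 h1 i k G) (norm_nonneg _) hK
  · have hx : ∀ i, HasDerivAt (fun r => linField (L r) G i) (linField (L' s) G i) s := fun i =>
      HasDerivAt.fun_sum fun k _ => (hd s i k).mul_const (G k)
    refine ((hasDerivAt_expSum (x := fun r => linField (L r) G) hx).rpow_const (p := γ)
      (Or.inl (expSum_pos _).ne')).congr_deriv ?_
    rw [Finset.sum_mul, Finset.sum_mul, Finset.mul_sum]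
    exact Finset.sum_congr rfl fun j _ => by ring

end GaussianComparison

/-! ### Comparison of two Gaussian fields -/

namespace GaussianComparison

variable {κ₁ κ₂ : Type*} [Fintype κ₁] [Fintype κ₂]

/-- If two Gaussian fields on a finite set have the same variances and the first has the larger
covariances, then the powers `γ ∈ [0, 1]` of the partition function have smaller expectation for
the first field. The two fields, made independent, are joined by the path `cos t • u + sin t • w`. -/
theorem integral_expSum_rpow_le {ι : Type*} [Fintype ι] [Nonempty ι]
    (u : ι → κ₁ → ℝ) (w : ι → κ₂ → ℝ) {K : ℝ}
    (hu : ∀ i k, |u i k| ≤ K) (hw : ∀ i k, |w i k| ≤ K) (hK : 0 ≤ K)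
    (hvar : ∀ i, ∑ k, u i k * u i k = ∑ k, w i k * w i k)
    (hcov : ∀ i j, ∑ k, w i k * w j k ≤ ∑ k, u i k * u j k)
    {γ : ℝ} (h0 : 0 ≤ γ) (h1 : γ ≤ 1) :
    ∫ G, expSum (linField u G) ^ γ ∂stdGaussianPi κ₁
      ≤ ∫ G, expSum (linField w G) ^ γ ∂stdGaussianPi κ₂ := by
  let L : ℝ → ι → κ₁ ⊕ κ₂ → ℝ := fun t i =>
    Sum.elim (fun k => Real.cos t * u i k) fun k => Real.sin t * w i k
  let L' : ℝ → ι → κ₁ ⊕ κ₂ → ℝ := fun t i =>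
    Sum.elim (fun k => -Real.sin t * u i k) fun k => Real.cos t * w i k
  have hmul : ∀ a b : ℝ, |a| ≤ 1 → |b| ≤ K → |a * b| ≤ K := fun a b ha hb => by
    rw [abs_mul]
    exact (mul_le_of_le_one_left (abs_nonneg _) ha).trans hb
  have hL : ∀ t i k, |L t i k| ≤ K := by
    rintro t i (k | k)
    · exact hmul _ _ (Real.abs_cos_le_one t) (hu i k)
    · exact hmul _ _ (Real.abs_sin_le_one t) (hw i k)
  have hL' : ∀ t i k, |L' t i k| ≤ K := by
    rintro t i (k | k)
    · exact hmul _ _ (by rw [abs_neg]; exact Real.abs_sin_le_one t) (hu i k)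
    · exact hmul _ _ (Real.abs_cos_le_one t) (hw i k)
  have hd : ∀ t i k, HasDerivAt (fun s => L s i k) (L' t i k) t := by
    rintro t i (k | k)
    · exact (Real.hasDerivAt_cos t).mul_const _
    · exact (Real.hasDerivAt_sin t).mul_const _
  have hder := hasDerivAt_integral_expSum_rpow hK hL hL' hd h0 h1
  have hmono : MonotoneOn (fun t => ∫ G, expSum (linField (L t) G) ^ γ ∂stdGaussianPi (κ₁ ⊕ κ₂))
      (Set.Icc 0 (Real.pi / 2)) := by
    refine monotoneOn_of_deriv_nonneg (convex_Icc _ _)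
      (fun t _ => (hder t).continuousAt.continuousWithinAt)
      (fun t _ => (hder t).differentiableAt.differentiableWithinAt) fun t ht => ?_
    rw [interior_Icc] at ht
    have hprod : ∀ i j, ∑ k, L' t i k * L t j k = Real.sin t * Real.cos t
        * (∑ k, w i k * w j k - ∑ k, u i k * u j k) := fun i j => by
      simp only [L, L', Fintype.sum_sum_type, Sum.elim_inl, Sum.elim_inr, mul_sub, Finset.mul_sum]
      rw [add_comm, sub_eq_add_neg, ← Finset.sum_neg_distrib]
      congr 1 <;> exact Finset.sum_congr rfl fun k _ => by ring
    rw [(hder t).deriv, integral_const_mul]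
    refine mul_nonneg h0 (integral_sum_linField_mul_nonneg (L t) (L' t) hK (hL t) h0 h1
      (fun i => ?_) fun i j => ?_)
    · rw [hprod, hvar, sub_self, mul_zero]
    · rw [hprod]
      refine mul_nonpos_of_nonneg_of_nonpos (mul_nonneg
        (Real.sin_nonneg_of_nonneg_of_le_pi ht.1.le (by linarith [ht.2, Real.pi_pos]))
        (Real.cos_nonneg_of_neg_pi_div_two_le_of_le (by linarith [ht.1, Real.pi_pos]) ht.2.le))
        (sub_nonpos.2 (hcov i j))
  -- The endpoints `t = 0` and `t = π / 2` of the path are the two fields to be compared.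
  have hle := hmono (Set.left_mem_Icc.2 (by positivity)) (Set.right_mem_Icc.2 (by positivity))
    (by positivity : (0 : ℝ) ≤ Real.pi / 2)
  have e1 : ∀ G : κ₁ ⊕ κ₂ → ℝ, linField (L 0) G = linField u fun k => G (Sum.inl k) := fun G => by
    funext i
    simp [linField, L]
  have e2 : ∀ G : κ₁ ⊕ κ₂ → ℝ, linField (L (Real.pi / 2)) G = linField w fun k => G (Sum.inr k) :=
    fun G => by
      funext i
      simp [linField, L]
  simp only [e1, e2] at hle
  have m1 := measurePreserving_comp_injective (κ := κ₁ ⊕ κ₂) (κ' := κ₁) Sum.inl_injective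
  have m2 := measurePreserving_comp_injective (κ := κ₁ ⊕ κ₂) (κ' := κ₂) Sum.inr_injective
  rw [← m1.map_eq, ← m2.map_eq, integral_map m1.measurable.aemeasurable
    (Measurable.aestronglyMeasurable (by fun_prop)), integral_map m2.measurable.aemeasurable
    (Measurable.aestronglyMeasurable (by fun_prop))]
  exact hle

/-! ### Suprema of Gaussian fields over separable index spaces -/

section Sup

variable {T κ : Type*} [Fintype κ]

theorem bddAbove_range_linField {L : T → κ → ℝ} {K : ℝ} (hL : ∀ t k, |L t k| ≤ K) (G : κ → ℝ) :
    BddAbove (Set.range (linField L G)) :=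
  ⟨K * ∑ k, |G k|, by rintro _ ⟨t, rfl⟩; exact (le_abs_self _).trans (abs_linField_le hL G t)⟩

theorem abs_iSup_linField_le [Nonempty T] {L : T → κ → ℝ} {K : ℝ} (hL : ∀ t k, |L t k| ≤ K)
    (G : κ → ℝ) : |⨆ t, linField L G t| ≤ K * ∑ k, |G k| := by
  obtain ⟨t⟩ := ‹Nonempty T›
  refine abs_le.2 ⟨?_, ciSup_le fun t => (le_abs_self _).trans (abs_linField_le hL G t)⟩
  exact (neg_le_of_abs_le (abs_linField_le hL G t)).trans
    (le_ciSup (bddAbove_range_linField hL G) t)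

variable [TopologicalSpace T]

theorem continuous_linField {L : T → κ → ℝ} (hc : Continuous L) (G : κ → ℝ) :
    Continuous (linField L G) := by
  unfold linField
  fun_prop

theorem iSup_comp_eq_of_denseRange {f : T → ℝ} (hf : Continuous f)
    (hb : BddAbove (Set.range f)) {d : ℕ → T} (hd : DenseRange d) : ⨆ n, f (d n) = ⨆ t, f t := by
  have : Nonempty T := ⟨d 0⟩
  have hb' : BddAbove (Set.range fun n => f (d n)) := hb.mono (Set.range_comp_subset_range d f)
  refine le_antisymm (ciSup_le fun n => le_ciSup hb (d n)) (ciSup_le fun t => ?_)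
  exact hd.induction_on (p := fun t => f t ≤ ⨆ n, f (d n)) t
    (isClosed_le hf continuous_const) fun n => le_ciSup hb' n

variable [TopologicalSpace.SeparableSpace T] [Nonempty T]

theorem measurable_iSup_linField {L : T → κ → ℝ} (hc : Continuous L) {K : ℝ}
    (hL : ∀ t k, |L t k| ≤ K) : Measurable fun G => ⨆ t, linField L G t := by
  have h : (fun G => ⨆ t, linField L G t)
      = fun G => ⨆ n, linField L G (TopologicalSpace.denseSeq T n) := by
    funext G
    rw [iSup_comp_eq_of_denseRange (continuous_linField hc G) (bddAbove_range_linField hL G)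
      (TopologicalSpace.denseRange_denseSeq T)]
  rw [h]
  exact Measurable.iSup fun n => measurable_linField L _

theorem integrable_exp_mul_iSup_linField {L : T → κ → ℝ} (hc : Continuous L) {K : ℝ}
    (hL : ∀ t k, |L t k| ≤ K) (c : ℝ) :
    Integrable (fun G => Real.exp (c * ⨆ t, linField L G t)) (stdGaussianPi κ) := by
  have hm := measurable_iSup_linField hc hL
  refine integrable_of_abs_le_exp (C := 1) (K := |c| * K) (by fun_prop) fun G => ?_
  rw [Real.abs_exp, one_mul, Real.exp_le_exp, mul_assoc]
  refine (le_abs_self _).trans ?_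
  rw [abs_mul]
  exact mul_le_mul_of_nonneg_left (abs_iSup_linField_le hL G) (abs_nonneg c)

end Sup

theorem linField_smul {ι κ : Type*} [Fintype κ] (a : ℝ) (L : ι → κ → ℝ) (G : κ → ℝ) (i : ι) :
    linField (fun i k => a * L i k) G i = a * linField L G i := by
  simp only [linField, Finset.mul_sum, mul_assoc]

theorem sum_mul_mul_mul_mul {κ : Type*} [Fintype κ] (a : ℝ) (x y : κ → ℝ) :
    ∑ k, a * x k * (a * y k) = a ^ 2 * ∑ k, x k * y k := by
  rw [Finset.mul_sum]
  exact Finset.sum_congr rfl fun k _ => by ring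

/-- Comparison of exponential moments of finite maxima: `exp (c maxᵢ xᵢ)` is within a factor
`card ι ^ γ` of `(∑ᵢ exp (c xᵢ / γ)) ^ γ`. The functions `f` and `g` are a lower bound for the
maximum of the first field and an upper bound for that of the second. -/
theorem integral_exp_sup_le_card_rpow_mul {ι : Type*} [Fintype ι] [Nonempty ι]
    (u : ι → κ₁ → ℝ) (w : ι → κ₂ → ℝ) {K : ℝ}
    (hu : ∀ i k, |u i k| ≤ K) (hw : ∀ i k, |w i k| ≤ K) (hK : 0 ≤ K)
    (hvar : ∀ i, ∑ k, u i k * u i k = ∑ k, w i k * w i k)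
    (hcov : ∀ i j, ∑ k, w i k * w j k ≤ ∑ k, u i k * u j k)
    {c : ℝ} (hc : 0 ≤ c) {γ : ℝ} (h0 : 0 < γ) (h1 : γ ≤ 1)
    {f : (κ₁ → ℝ) → ℝ} {g : (κ₂ → ℝ) → ℝ}
    (hf : ∀ G, ∃ i, f G ≤ linField u G i) (hg : ∀ G i, linField w G i ≤ g G)
    (hfi : Integrable (fun G => Real.exp (c * f G)) (stdGaussianPi κ₁))
    (hgi : Integrable (fun G => Real.exp (c * g G)) (stdGaussianPi κ₂)) :
    ∫ G, Real.exp (c * f G) ∂stdGaussianPi κ₁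
      ≤ (Fintype.card ι : ℝ) ^ γ * ∫ G, Real.exp (c * g G) ∂stdGaussianPi κ₂ := by
  set a := c / γ with ha
  have ha0 : 0 ≤ a := div_nonneg hc h0.le
  have haγ : a * γ = c := div_mul_cancel₀ c h0.ne'
  have hbd : ∀ x : ℝ, |x| ≤ K → |a * x| ≤ a * K := fun x hx => by
    rw [abs_mul, abs_of_nonneg ha0]
    exact mul_le_mul_of_nonneg_left hx ha0
  have hbu : ∀ i k, |a * u i k| ≤ a * K := fun i k => hbd _ (hu i k)
  have hbw : ∀ i k, |a * w i k| ≤ a * K := fun i k => hbd _ (hw i k)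
  have haK : 0 ≤ a * K := mul_nonneg ha0 hK
  calc ∫ G, Real.exp (c * f G) ∂stdGaussianPi κ₁
      ≤ ∫ G, expSum (linField (fun i k => a * u i k) G) ^ γ ∂stdGaussianPi κ₁ := by
        refine integral_mono hfi (integrable_expSum_rpow _ haK hbu h0.le h1) fun G => ?_
        obtain ⟨i, hi⟩ := hf G
        have h2 : Real.exp (a * f G) ≤ expSum (linField (fun i k => a * u i k) G) := by
          refine le_trans ?_ (exp_le_expSum _ i)
          rw [linField_smul, Real.exp_le_exp]
          exact mul_le_mul_of_nonneg_left hi ha0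
        calc Real.exp (c * f G) = Real.exp (a * f G) ^ γ := by
              rw [← Real.exp_mul, ← haγ]
              congr 1
              ring
          _ ≤ _ := Real.rpow_le_rpow (Real.exp_pos _).le h2 h0.le
    _ ≤ ∫ G, expSum (linField (fun i k => a * w i k) G) ^ γ ∂stdGaussianPi κ₂ := by
        refine integral_expSum_rpow_le _ _ hbu hbw haK (fun i => ?_) (fun i j => ?_) h0.le h1
        · rw [sum_mul_mul_mul_mul, sum_mul_mul_mul_mul, hvar]
        · rw [sum_mul_mul_mul_mul, sum_mul_mul_mul_mul]
          exact mul_le_mul_of_nonneg_left (hcov i j) (sq_nonneg a)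
    _ ≤ ∫ G, (Fintype.card ι : ℝ) ^ γ * Real.exp (c * g G) ∂stdGaussianPi κ₂ := by
        refine integral_mono (integrable_expSum_rpow _ haK hbw h0.le h1) (hgi.const_mul _)
          fun G => ?_
        have h2 : expSum (linField (fun i k => a * w i k) G)
            ≤ Fintype.card ι * Real.exp (a * g G) := by
          refine (Finset.sum_le_sum (g := fun _ => Real.exp (a * g G)) fun i _ => ?_).trans
            (by simp)
          rw [linField_smul, Real.exp_le_exp]
          exact mul_le_mul_of_nonneg_left (hg G i) ha0
        calc _ ≤ (Fintype.card ι * Real.exp (a * g G)) ^ γ :=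
              Real.rpow_le_rpow (expSum_pos _).le h2 h0.le
          _ = _ := by
              rw [Real.mul_rpow (Nat.cast_nonneg _) (Real.exp_pos _).le, ← Real.exp_mul, ← haγ]
              congr 2
              ring
    _ = _ := integral_const_mul _ _

/-- **Slepian's comparison for exponential moments of suprema.** Two Gaussian fields on a separable
space have the same variances, and the first has the larger covariances; then the exponential
moments of its supremum are smaller. -/
theorem integral_exp_mul_iSup_linField_le {T : Type*} [TopologicalSpace T]
    [TopologicalSpace.SeparableSpace T] [Nonempty T]
    {u : T → κ₁ → ℝ} {w : T → κ₂ → ℝ} (hcu : Continuous u) (hcw : Continuous w)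
    {K : ℝ} (hu : ∀ i k, |u i k| ≤ K) (hw : ∀ i k, |w i k| ≤ K) (hK : 0 ≤ K)
    (hvar : ∀ i, ∑ k, u i k * u i k = ∑ k, w i k * w i k)
    (hcov : ∀ i j, ∑ k, w i k * w j k ≤ ∑ k, u i k * u j k) {c : ℝ} (hc : 0 ≤ c) :
    ∫ G, Real.exp (c * ⨆ t, linField u G t) ∂stdGaussianPi κ₁
      ≤ ∫ G, Real.exp (c * ⨆ t, linField w G t) ∂stdGaussianPi κ₂ := by
  set d := TopologicalSpace.denseSeq T with hd
  let m : ℕ → (κ₁ → ℝ) → ℝ := fun N G => partialSups (fun n => linField u G (d n)) N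
  have hbdd : ∀ G, BddAbove (Set.range fun n => linField u G (d n)) := fun G =>
    (bddAbove_range_linField hu G).mono (Set.range_comp_subset_range d (linField u G))
  have hmem : ∀ N G, ∃ i : Fin (N + 1), m N G = linField u G (d i) := fun N G => by
    obtain ⟨i, hi, h⟩ := exists_partialSups_eq (fun n => linField u G (d n)) N
    exact ⟨⟨i, Nat.lt_succ_of_le hi⟩, h⟩
  have hmabs : ∀ N G, |m N G| ≤ K * ∑ k, |G k| := fun N G => by
    obtain ⟨i, hi⟩ := hmem N G
    rw [hi]
    exact abs_linField_le hu G _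
  have hmm : ∀ N, Measurable (m N) := fun N => by
    induction N with
    | zero => simpa [m] using measurable_linField u (d 0)
    | succ N ih =>
      have : m (N + 1) = fun G => m N G ⊔ linField u G (d (N + 1)) := by
        funext G
        simp only [m, partialSups_add_one]
      rw [this]
      exact ih.sup (measurable_linField u _)
  have hexp : ∀ N G, ‖Real.exp (c * m N G)‖ ≤ Real.exp ((c * K) * ∑ k, |G k|) := fun N G => by
    rw [Real.norm_eq_abs, Real.abs_exp, Real.exp_le_exp, mul_assoc]
    exact mul_le_mul_of_nonneg_left ((le_abs_self _).trans (hmabs N G)) hc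
  have hlim : Filter.Tendsto (fun N => ∫ G, Real.exp (c * m N G) ∂stdGaussianPi κ₁) Filter.atTop
      (nhds (∫ G, Real.exp (c * ⨆ t, linField u G t) ∂stdGaussianPi κ₁)) := by
    refine tendsto_integral_of_dominated_convergence _ (fun N => ?_)
      (integrable_exp_mul_sum_abs (c * K)) (fun N => ae_of_all _ (hexp N))
      (ae_of_all _ fun G => ?_)
    · have := hmm N
      exact Measurable.aestronglyMeasurable (by fun_prop)
    · refine (Real.continuous_exp.tendsto _).comp (Filter.Tendsto.const_mul c ?_)
      have h2 := tendsto_atTop_ciSup (partialSups fun n => linField u G (d n)).monotone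
        (bddAbove_range_partialSups.2 (hbdd G))
      rwa [ciSup_partialSups_eq (hbdd G), iSup_comp_eq_of_denseRange (continuous_linField hcu G)
        (bddAbove_range_linField hu G) (TopologicalSpace.denseRange_denseSeq T)] at h2
  refine le_of_tendsto' hlim fun N => ?_
  -- The factor `(N + 1) ^ γ` tends to `1` as `γ → 0`.
  have hstep : ∀ γ : ℝ, γ ∈ Set.Ioc (0 : ℝ) 1 → ∫ G, Real.exp (c * m N G) ∂stdGaussianPi κ₁
      ≤ (Fintype.card (Fin (N + 1)) : ℝ) ^ γ
        * ∫ G, Real.exp (c * ⨆ t, linField w G t) ∂stdGaussianPi κ₂ := fun γ hγ => by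
    refine integral_exp_sup_le_card_rpow_mul (fun i : Fin (N + 1) => u (d i)) (fun i => w (d i))
      (fun i => hu _) (fun i => hw _) hK (fun i => hvar _) (fun i j => hcov _ _) hc hγ.1 hγ.2
      (fun G => ?_) (fun G i => le_ciSup (bddAbove_range_linField hw G) (d i)) ?_
      (integrable_exp_mul_iSup_linField hcw hw c)
    · obtain ⟨i, hi⟩ := hmem N G
      exact ⟨i, hi.le⟩
    · have := hmm N
      exact (integrable_exp_mul_sum_abs (c * K)).mono'
        (Measurable.aestronglyMeasurable (by fun_prop)) (ae_of_all _ (hexp N))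
  have hpow : Filter.Tendsto (fun γ : ℝ => (Fintype.card (Fin (N + 1)) : ℝ) ^ γ
      * ∫ G, Real.exp (c * ⨆ t, linField w G t) ∂stdGaussianPi κ₂) (nhdsWithin 0 (Set.Ioi 0))
      (nhds (∫ G, Real.exp (c * ⨆ t, linField w G t) ∂stdGaussianPi κ₂)) := by
    have h2 := (Real.continuousAt_const_rpow (a := (Fintype.card (Fin (N + 1)) : ℝ)) (b := 0)
      (by simp; positivity)).tendsto.mul_const
        (∫ G, Real.exp (c * ⨆ t, linField w G t) ∂stdGaussianPi κ₂)
    rw [Real.rpow_zero, one_mul] at h2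
    exact h2.mono_left nhdsWithin_le_nhds
  refine ge_of_tendsto hpow ?_
  filter_upwards [Ioc_mem_nhdsGT (zero_lt_one' ℝ)] with γ hγ using hstep γ hγ

end GaussianComparison

/-! ### Random variables and added independent Gaussians -/

namespace GaussianComparison

theorem hasLaw_stdGaussianPi {Ω κ : Type*} [MeasurableSpace Ω] {μ : Measure Ω}
    [IsProbabilityMeasure μ] [Fintype κ] {X : κ → Ω → ℝ}
    (hX : ∀ k, HasLaw (X k) (gaussianReal 0 1) μ) (hind : iIndepFun X μ) :
    HasLaw (fun ω k => X k ω) (stdGaussianPi κ) μ where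
  aemeasurable := aemeasurable_pi_lambda _ fun k => (hX k).aemeasurable
  map_eq := by
    rw [(iIndepFun_iff_map_fun_eq_pi_map fun k => (hX k).aemeasurable).1 hind]
    simp only [(hX _).map_eq]

theorem integrable_comp_and_integral_comp {Ω κ : Type*} [MeasurableSpace Ω] {μ : Measure Ω}
    [Fintype κ] {X : Ω → κ → ℝ} (hX : HasLaw X (stdGaussianPi κ) μ) {f : (κ → ℝ) → ℝ}
    (hf : Integrable f (stdGaussianPi κ)) :
    Integrable (fun ω => f (X ω)) μ ∧ ∫ ω, f (X ω) ∂μ = ∫ G, f G ∂stdGaussianPi κ := by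
  rw [← hX.map_eq] at hf ⊢
  exact ⟨hf.comp_aemeasurable hX.aemeasurable, (integral_map hX.aemeasurable hf.1).symm⟩

/-- Adding the independent Gaussian variable `a • G none` to a Gaussian field multiplies the
exponential moment of its supremum by `exp ((c a) ^ 2 / 2)`. -/
theorem integral_exp_mul_iSup_linField_option {T κ : Type*} [Fintype κ] [TopologicalSpace T]
    [TopologicalSpace.SeparableSpace T] [Nonempty T] {u : T → κ → ℝ} (hcu : Continuous u)
    {K : ℝ} (hu : ∀ t k, |u t k| ≤ K) (a c : ℝ) :
    ∫ G, Real.exp (c * ⨆ t, linField (fun t (k : Option κ) => k.elim a (u t)) G t)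
        ∂stdGaussianPi (Option κ)
      = Real.exp ((c * a) ^ 2 / 2)
        * ∫ G, Real.exp (c * ⨆ t, linField u G t) ∂stdGaussianPi κ := by
  classical
  have hsup : ∀ G : Option κ → ℝ, ⨆ t, linField (fun t (k : Option κ) => k.elim a (u t)) G t
      = a * G none + ⨆ t, linField u (fun k => G (some k)) t := fun G => by
    rw [add_comm, ciSup_add (bddAbove_range_linField hu _)]
    refine iSup_congr fun t => ?_
    simp only [linField, Fintype.sum_option, Option.elim_none, Option.elim_some]
    ring
  have hbd : ∀ t (k : Option κ), |k.elim a (u t)| ≤ max |a| K := by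
    rintro t (_ | k)
    · exact le_max_left _ _
    · exact (hu t k).trans (le_max_right _ _)
  have hcont : Continuous fun t (k : Option κ) => k.elim a (u t) := by
    refine continuous_pi ?_
    rintro (_ | k)
    · exact continuous_const
    · exact (continuous_apply k).comp hcu
  rw [integral_eq_integral_update none (integrable_exp_mul_iSup_linField hcont hbd c)]
  simp only [hsup, Function.update_self, mul_add, Real.exp_add]
  have hmgf : ∫ x, Real.exp (c * (a * x)) ∂gaussianReal 0 1 = Real.exp ((c * a) ^ 2 / 2) := by
    have h := mgf_gaussianReal (p := gaussianReal 0 1) (X := id) (μ := 0) (v := 1)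
      Measure.map_id (c * a)
    simpa [mgf, mul_assoc] using h
  have hne : ∀ (G : Option κ → ℝ) (x : ℝ) (k : κ),
      Function.update G none x (some k) = G (some k) := fun G x k =>
    Function.update_of_ne (Option.some_ne_none k) _ _
  simp only [hne, integral_mul_const, hmgf, integral_const_mul]
  congr 1
  have hm := measurePreserving_comp_injective (κ := Option κ) (κ' := κ) (Option.some_injective κ)
  have hms := measurable_iSup_linField hcu hu
  rw [← hm.map_eq, integral_map hm.measurable.aemeasurable
    (Measurable.aestronglyMeasurable (by fun_prop))]

end GaussianComparison

/-! ### Covariances of the spin fields -/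

namespace MultipartiteSpin

open GaussianComparison

variable {n p : ℕ} {S : Fin p → Set (EuclideanSpace ℝ (Fin n))}

/-- The coefficients of the `p`-spin form at `x⁽¹⁾, …, x⁽ᵖ⁾`. -/
def spinCoeff (x : Fin p → EuclideanSpace ℝ (Fin n)) (i : Fin p → Fin n) : ℝ := ∏ k, x k (i k)

theorem abs_spinCoeff_le_one {x : Fin p → EuclideanSpace ℝ (Fin n)}
    (hx : ∀ j, x j ∈ Metric.sphere (0 : EuclideanSpace ℝ (Fin n)) 1) (i : Fin p → Fin n) :
    |spinCoeff x i| ≤ 1 := by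
  rw [spinCoeff, Finset.abs_prod]
  exact Finset.prod_le_one (fun _ _ => abs_nonneg _) fun k _ => abs_coord_le_one (hx k) _

theorem sum_spinCoeff_mul (x y : Fin p → EuclideanSpace ℝ (Fin n)) :
    ∑ i, spinCoeff x i * spinCoeff y i = ∏ j, ∑ i, x j i * y j i := by
  simp only [spinCoeff, ← Finset.prod_mul_distrib]
  rw [Finset.prod_univ_sum, Fintype.piFinset_univ]

theorem spinForm_eq_linField {T : Type*} (f : T → Fin p → EuclideanSpace ℝ (Fin n))
    (A : (Fin p → Fin n) → ℝ) (t : T) :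
    spinForm A (f t) = linField (fun t => spinCoeff (f t)) A t :=
  Finset.sum_congr rfl fun _ _ => mul_comm _ _

theorem sum_mul_self_of_mem_sphere {x : EuclideanSpace ℝ (Fin n)}
    (hx : x ∈ Metric.sphere (0 : EuclideanSpace ℝ (Fin n)) 1) : ∑ i, x i * x i = 1 := by
  have h := EuclideanSpace.real_norm_sq_eq x
  rw [mem_sphere_zero_iff_norm.1 hx] at h
  simpa [sq] using h.symm

theorem abs_sum_mul_le_one {x y : EuclideanSpace ℝ (Fin n)}
    (hx : x ∈ Metric.sphere (0 : EuclideanSpace ℝ (Fin n)) 1)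
    (hy : y ∈ Metric.sphere (0 : EuclideanSpace ℝ (Fin n)) 1) : |∑ i, x i * y i| ≤ 1 := by
  have h := abs_real_inner_le_norm y x
  rw [mem_sphere_zero_iff_norm.1 hx, mem_sphere_zero_iff_norm.1 hy] at h
  simpa [PiLp.inner_apply] using h

theorem one_sub_prod_le_sum {ι : Type*} (s : Finset ι) {a : ι → ℝ} (ha : ∀ j ∈ s, |a j| ≤ 1) :
    1 - ∏ j ∈ s, a j ≤ ∑ j ∈ s, (1 - a j) := by
  classical
  induction s using Finset.induction_on with
  | empty => simp
  | insert j s hj ih =>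
    rw [Finset.prod_insert hj, Finset.sum_insert hj]
    have ih' := ih fun i hi => ha i (Finset.mem_insert_of_mem hi)
    have h1 := abs_le.1 (ha j (Finset.mem_insert_self _ _))
    have h2 : |∏ i ∈ s, a i| ≤ 1 := by
      rw [Finset.abs_prod]
      exact Finset.prod_le_one (fun _ _ => abs_nonneg _)
        fun i hi => ha i (Finset.mem_insert_of_mem hi)
    nlinarith [abs_le.1 h2, mul_nonneg (sub_nonneg.2 h1.2) (sub_nonneg.2 (abs_le.1 h2).2)]

/-- The arithmetic-geometric mean inequality; evenness of `p` makes it insensitive to signs. -/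
theorem prod_le_inv_mul_sum_pow (hp : 0 < p) (hpe : Even p) (a : Fin p → ℝ) :
    ∏ j, a j ≤ (p : ℝ)⁻¹ * ∑ j, a j ^ p := by
  have hp0 : (p : ℝ) ≠ 0 := by positivity
  have h := Real.geom_mean_le_arith_mean_weighted Finset.univ (fun _ : Fin p => (p : ℝ)⁻¹)
    (fun j => |a j| ^ p) (fun _ _ => by positivity) (by simp [hp0])
    fun _ _ => by positivity
  simp only [Real.pow_rpow_inv_natCast (abs_nonneg _) hp.ne'] at h
  simp only [hpe.pow_abs] at h
  rw [Finset.mul_sum]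
  refine le_trans ?_ h
  rw [← Finset.abs_prod]
  exact le_abs_self _

theorem continuous_spinCoeff {T : Type*} [TopologicalSpace T]
    {f : T → Fin p → EuclideanSpace ℝ (Fin n)} (hf : Continuous f) :
    Continuous fun t => spinCoeff (f t) := by
  unfold spinCoeff
  fun_prop

/-! ### The three maxima as suprema of Gaussian fields -/

theorem groundMax_eq_iSup_linField (A : (Fin p → Fin n) → ℝ) :
    groundMax S A = ⨆ x : Config S, linField (fun x : Config S =>
      spinCoeff fun j => (x j : EuclideanSpace ℝ (Fin n))) A x :=
  iSup_congr fun x => spinForm_eq_linField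
    (fun (x : Config S) j => (x j : EuclideanSpace ℝ (Fin n))) A x

theorem linearMax_eq_iSup_linField (g : Fin p → Fin n → ℝ) :
    linearMax S g = ⨆ x : Config S, linField (fun (x : Config S) (q : Fin p × Fin n) =>
      (x q.1 : EuclideanSpace ℝ (Fin n)) q.2) (fun q => g q.1 q.2) x := by
  refine iSup_congr fun x => ?_
  rw [linField, Fintype.sum_prod_type]
  simp only [mul_comm]

theorem inv_sqrt_mul_singleMax_eq_iSup_linField (B : Fin p → (Fin p → Fin n) → ℝ) :
    (√(p : ℝ))⁻¹ * singleMax S B = ⨆ x : Config S,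
      linField (fun (x : Config S) (q : Fin p × (Fin p → Fin n)) => (√(p : ℝ))⁻¹ *
        spinCoeff (fun _ : Fin p => (x q.1 : EuclideanSpace ℝ (Fin n))) q.2)
        (fun q => B q.1 q.2) x := by
  rw [singleMax, Real.mul_iSup_of_nonneg (by positivity)]
  refine iSup_congr fun x => ?_
  rw [linField, Fintype.sum_prod_type]
  simp only [spinForm, spinCoeff, Finset.mul_sum]
  exact Finset.sum_congr rfl fun j _ => Finset.sum_congr rfl fun i _ => by ring

end MultipartiteSpin

/-! ### Comparison of the spin fields -/

namespace MultipartiteSpin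

open GaussianComparison

variable {n p : ℕ} {S : Fin p → Set (EuclideanSpace ℝ (Fin n))}

theorem continuous_config :
    Continuous fun (x : Config S) (j : Fin p) => (x j : EuclideanSpace ℝ (Fin n)) := by
  fun_prop

/-- Comparison of the field `p^{-1/2} ∑ⱼ B⁽ʲ⁾(x⁽ʲ⁾, …, x⁽ʲ⁾)` with the `p`-spin field: both have
variance `1`, and their covariances are the two sides of the arithmetic-geometric mean
inequality for the overlaps `⟨x⁽ʲ⁾, y⁽ʲ⁾⟩`. -/
theorem integral_exp_singleMax_le (hp : 0 < p) (hpe : Even p)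
    (hS : ∀ j, S j ⊆ Metric.sphere (0 : EuclideanSpace ℝ (Fin n)) 1)
    (hne : ∀ j, (S j).Nonempty) {c : ℝ} (hc : 0 ≤ c) :
    Integrable (fun G : Fin p × (Fin p → Fin n) → ℝ =>
        Real.exp ((√(p : ℝ))⁻¹ * c * singleMax S fun j i => G (j, i))) (stdGaussianPi _) ∧
      ∫ G : Fin p × (Fin p → Fin n) → ℝ,
          Real.exp ((√(p : ℝ))⁻¹ * c * singleMax S fun j i => G (j, i)) ∂stdGaussianPi _
        ≤ ∫ A, Real.exp (c * groundMax S A) ∂stdGaussianPi (Fin p → Fin n) := by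
  have : ∀ j, Nonempty (S j) := fun j => (hne j).to_subtype
  have hp0 : (0 : ℝ) < p := by exact_mod_cast hp
  have hsq : (√(p : ℝ))⁻¹ ^ 2 = (p : ℝ)⁻¹ := by rw [inv_pow, Real.sq_sqrt hp0.le]
  have hs1 : |(√(p : ℝ))⁻¹| ≤ 1 := by
    rw [abs_of_nonneg (by positivity)]
    exact inv_le_one_of_one_le₀ (Real.one_le_sqrt.2 (by exact_mod_cast hp))
  have hmem : ∀ (x : Config S) j, (x j : EuclideanSpace ℝ (Fin n)) ∈ Metric.sphere 0 1 :=
    fun x j => hS j (x j).2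
  have hcu : Continuous fun (x : Config S) (q : Fin p × (Fin p → Fin n)) =>
      (√(p : ℝ))⁻¹ * spinCoeff (fun _ : Fin p => (x q.1 : EuclideanSpace ℝ (Fin n))) q.2 := by
    unfold spinCoeff
    fun_prop
  have hbu : ∀ (x : Config S) (q : Fin p × (Fin p → Fin n)), |(√(p : ℝ))⁻¹ *
      spinCoeff (fun _ : Fin p => (x q.1 : EuclideanSpace ℝ (Fin n))) q.2| ≤ 1 := fun x q => by
    rw [abs_mul]
    exact mul_le_one₀ hs1 (abs_nonneg _) (abs_spinCoeff_le_one (fun _ => hmem x q.1) q.2)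
  have hcov : ∀ x y : Config S, ∑ q : Fin p × (Fin p → Fin n),
      (√(p : ℝ))⁻¹ * spinCoeff (fun _ : Fin p => (x q.1 : EuclideanSpace ℝ (Fin n))) q.2 *
        ((√(p : ℝ))⁻¹ * spinCoeff (fun _ : Fin p => (y q.1 : EuclideanSpace ℝ (Fin n))) q.2)
      = (p : ℝ)⁻¹ * ∑ j, (∑ i, (x j : EuclideanSpace ℝ (Fin n)) i *
          (y j : EuclideanSpace ℝ (Fin n)) i) ^ p := fun x y => by
    rw [sum_mul_mul_mul_mul, hsq, Fintype.sum_prod_type]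
    simp only [sum_spinCoeff_mul, Finset.prod_const, Finset.card_univ, Fintype.card_fin]
  have hexp : ∀ G : Fin p × (Fin p → Fin n) → ℝ,
      (√(p : ℝ))⁻¹ * c * singleMax S (fun j i => G (j, i)) = c * ⨆ x : Config S,
        linField (fun (x : Config S) (q : Fin p × (Fin p → Fin n)) => (√(p : ℝ))⁻¹ *
          spinCoeff (fun _ : Fin p => (x q.1 : EuclideanSpace ℝ (Fin n))) q.2) G x := fun G => by
    rw [← inv_sqrt_mul_singleMax_eq_iSup_linField fun j i => G (j, i)]
    ring
  simp only [hexp, groundMax_eq_iSup_linField]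
  refine ⟨integrable_exp_mul_iSup_linField hcu hbu c, integral_exp_mul_iSup_linField_le hcu
    (continuous_spinCoeff continuous_config) hbu (fun x i => abs_spinCoeff_le_one (hmem x) i)
    zero_le_one (fun x => ?_) (fun x y => ?_) hc⟩
  · rw [hcov, sum_spinCoeff_mul]
    simp only [sum_mul_self_of_mem_sphere (hmem x _), one_pow, Finset.prod_const_one,
      Finset.sum_const, Finset.card_univ, Fintype.card_fin, nsmul_eq_mul, mul_one]
    exact inv_mul_cancel₀ hp0.ne'
  · rw [hcov, sum_spinCoeff_mul]
    exact prod_le_inv_mul_sum_pow hp hpe _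

/-- Comparison of the `p`-spin field with the linear field. The former, of variance `1`, is
brought to the variance `p` of the latter by adding `√(p - 1)` times an independent standard
Gaussian, which accounts for the factor on the left. -/
theorem exp_mul_integral_exp_groundMax_le (hp : 0 < p)
    (hS : ∀ j, S j ⊆ Metric.sphere (0 : EuclideanSpace ℝ (Fin n)) 1)
    (hne : ∀ j, (S j).Nonempty) {c : ℝ} (hc : 0 ≤ c) :
    Integrable (fun A => Real.exp (c * groundMax S A)) (stdGaussianPi (Fin p → Fin n)) ∧
      Integrable (fun G : Fin p × Fin n → ℝ =>
        Real.exp (c * linearMax S fun j i => G (j, i))) (stdGaussianPi _) ∧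
      Real.exp (c ^ 2 * ((p : ℝ) - 1) / 2)
          * ∫ A, Real.exp (c * groundMax S A) ∂stdGaussianPi (Fin p → Fin n)
        ≤ ∫ G : Fin p × Fin n → ℝ,
          Real.exp (c * linearMax S fun j i => G (j, i)) ∂stdGaussianPi _ := by
  have : ∀ j, Nonempty (S j) := fun j => (hne j).to_subtype
  have hp1 : (0 : ℝ) ≤ (p : ℝ) - 1 := sub_nonneg.2 (by exact_mod_cast hp)
  have hmem : ∀ (x : Config S) j, (x j : EuclideanSpace ℝ (Fin n)) ∈ Metric.sphere 0 1 :=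
    fun x j => hS j (x j).2
  let w : Config S → Fin p × Fin n → ℝ := fun x q => (x q.1 : EuclideanSpace ℝ (Fin n)) q.2
  let u : Config S → (Fin p → Fin n) → ℝ :=
    fun x => spinCoeff fun j => (x j : EuclideanSpace ℝ (Fin n))
  let a : ℝ := √((p : ℝ) - 1)
  have hcu : Continuous u := continuous_spinCoeff continuous_config
  have hcw : Continuous w := by fun_prop
  have hbu : ∀ x i, |u x i| ≤ 1 := fun x i => abs_spinCoeff_le_one (hmem x) i
  have hbw : ∀ x q, |w x q| ≤ 1 := fun x q => abs_coord_le_one (hmem x q.1) q.2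
  have hcv : Continuous fun x (k : Option (Fin p → Fin n)) => k.elim a (u x) := by
    refine continuous_pi ?_
    rintro (_ | k)
    · exact continuous_const
    · exact (continuous_apply k).comp hcu
  have hbv : ∀ x (k : Option (Fin p → Fin n)), |k.elim a (u x)| ≤ max a 1 := by
    rintro x (_ | k)
    · exact (abs_of_nonneg (Real.sqrt_nonneg _)).trans_le (le_max_left _ _)
    · exact (hbu x k).trans (le_max_right _ _)
  have hcovv : ∀ x y : Config S, ∑ k : Option (Fin p → Fin n), k.elim a (u x) * k.elim a (u y)
      = (p : ℝ) - 1 + ∏ j, ∑ i, (x j : EuclideanSpace ℝ (Fin n)) i *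
          (y j : EuclideanSpace ℝ (Fin n)) i := fun x y => by
    rw [Fintype.sum_option]
    simp only [Option.elim_none, Option.elim_some]
    rw [← sum_spinCoeff_mul, Real.mul_self_sqrt hp1]
  have hcovw : ∀ x y : Config S, ∑ q, w x q * w y q
      = ∑ j, ∑ i, (x j : EuclideanSpace ℝ (Fin n)) i * (y j : EuclideanSpace ℝ (Fin n)) i :=
    fun x y => Fintype.sum_prod_type _
  have hcard : ∑ _j : Fin p, (1 : ℝ) = p := by simp
  have hle := integral_exp_mul_iSup_linField_le hcv hcw hbv
    (fun x q => (hbw x q).trans (le_max_right a 1)) (zero_le_one.trans (le_max_right a 1))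
    (fun x => by
      rw [hcovv, hcovw]
      simp only [sum_mul_self_of_mem_sphere (hmem x _), Finset.prod_const_one, hcard]
      ring)
    (fun x y => by
      rw [hcovv, hcovw]
      have h := one_sub_prod_le_sum Finset.univ fun j (_ : j ∈ Finset.univ) =>
        abs_sum_mul_le_one (hmem x j) (hmem y j)
      rw [Finset.sum_sub_distrib, hcard] at h
      linarith) hc
  rw [integral_exp_mul_iSup_linField_option hcu hbu,
    show (c * a) ^ 2 / 2 = c ^ 2 * ((p : ℝ) - 1) / 2 by rw [mul_pow, Real.sq_sqrt hp1]] at hle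
  simp only [groundMax_eq_iSup_linField, linearMax_eq_iSup_linField]
  exact ⟨integrable_exp_mul_iSup_linField hcu hbu c, integrable_exp_mul_iSup_linField hcw hbw c,
    hle⟩

end MultipartiteSpin

theorem theorem1 {Ω : Type*} [MeasurableSpace Ω] (μ : Measure Ω) [IsProbabilityMeasure μ]
    (n p : ℕ) (hn : 0 < n) (hp : 0 < p) (hpe : Even p)
    (S : Fin p → Set (EuclideanSpace ℝ (Fin n)))
    (hS : ∀ j, S j ⊆ Metric.sphere (0 : EuclideanSpace ℝ (Fin n)) 1)
    (hne : ∀ j, (S j).Nonempty)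
    (A : (Fin p → Fin n) → Ω → ℝ)
    (hA : ∀ i, HasLaw (A i) (gaussianReal 0 1) μ)
    (hAind : iIndepFun A μ)
    (g : Fin p → Fin n → Ω → ℝ)
    (hg : ∀ j i, HasLaw (g j i) (gaussianReal 0 1) μ)
    (hgind : iIndepFun (fun q : Fin p × Fin n => g q.1 q.2) μ)
    (B : Fin p → (Fin p → Fin n) → Ω → ℝ)
    (hB : ∀ j i, HasLaw (B j i) (gaussianReal 0 1) μ)
    (hBind : iIndepFun (fun q : Fin p × (Fin p → Fin n) => B q.1 q.2) μ)
    (cl cu : ℝ) (hcl : 0 < cl) (hcu : 0 < cu) :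
    (Integrable (fun ω => Real.exp ((√(p : ℝ))⁻¹ * cl *
        MultipartiteSpin.singleMax S (fun j i => B j i ω))) μ ∧
      Integrable (fun ω => Real.exp (cl * MultipartiteSpin.groundMax S (fun i => A i ω))) μ ∧
      MultipartiteSpin.xiLower μ S B cl ≤ MultipartiteSpin.xi μ S A cl) ∧
    (Integrable (fun ω => Real.exp (cu * MultipartiteSpin.groundMax S (fun i => A i ω))) μ ∧
      Integrable (fun ω => Real.exp (cu * MultipartiteSpin.linearMax S (fun j i => g j i ω))) μ ∧
      MultipartiteSpin.xi μ S A cu ≤ MultipartiteSpin.xiUpper μ S g cu) := by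
  have lawA := GaussianComparison.hasLaw_stdGaussianPi hA hAind
  have lawg := GaussianComparison.hasLaw_stdGaussianPi
    (X := fun q : Fin p × Fin n => g q.1 q.2) (fun q => hg q.1 q.2) hgind
  have lawB := GaussianComparison.hasLaw_stdGaussianPi
    (X := fun q : Fin p × (Fin p → Fin n) => B q.1 q.2) (fun q => hB q.1 q.2) hBind
  obtain ⟨iB, hBA⟩ := MultipartiteSpin.integral_exp_singleMax_le hp hpe hS hne hcl.le
  obtain ⟨iAl, -, -⟩ := MultipartiteSpin.exp_mul_integral_exp_groundMax_le hp hS hne hcl.le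
  obtain ⟨iA, ig, hAg⟩ := MultipartiteSpin.exp_mul_integral_exp_groundMax_le hp hS hne hcu.le
  obtain ⟨jB, eB⟩ := GaussianComparison.integrable_comp_and_integral_comp lawB iB
  obtain ⟨jAl, eAl⟩ := GaussianComparison.integrable_comp_and_integral_comp lawA iAl
  obtain ⟨jA, eA⟩ := GaussianComparison.integrable_comp_and_integral_comp lawA iA
  obtain ⟨jg, eg⟩ := GaussianComparison.integrable_comp_and_integral_comp lawg ig
  refine ⟨⟨jB, jAl, ?_⟩, jA, jg, ?_⟩
  · rw [← eB, ← eAl] at hBA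
    unfold MultipartiteSpin.xiLower MultipartiteSpin.xi
    have := Real.log_le_log (integral_exp_pos jB) hBA
    gcongr
  · rw [← eA, ← eg] at hAg
    unfold MultipartiteSpin.xiUpper MultipartiteSpin.xi
    refine mul_le_mul_of_nonneg_left ?_ (by positivity)
    have hpos := integral_exp_pos jA
    have hlog := Real.log_le_log (mul_pos (Real.exp_pos _) hpos) hAg
    rw [Real.log_mul (Real.exp_pos _).ne' hpos.ne', Real.log_exp] at hlog
    have h := mul_le_mul_of_nonneg_left hlog (one_div_pos.2 hcu).le
    have hcancel : 1 / cu * (cu ^ 2 * ((p : ℝ) - 1) / 2) = cu / 2 * ((p : ℝ) - 1) := by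
      field_simp
    rw [mul_add, hcancel] at h
    linarith
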